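/- Let $\mathbb K$ be a commutative ring, $C$ a $\mathbb K$-coalgebra, $B$ a (unital associative) $\mathbb K$-algebra, $I=\{1,\dots,N\}$, and $(K_i)_{i\in I}$ a complete covering of $B$: two-sided ideals with $\bigcap_i K_i=0$ such that, with $B_i=B/K_i$, $B_{ij}=B/(K_i+K_j)$, $B_{ijk}=B/(K_i+K_j+K_k)$ and the canonical surjections $\pi^i_j:B_i\to B_{ij}$, $\pi^{ij}_k:B_{ij}\to B_{ijk}$, every family $(b_i)\in\prod_iB_i$ with $\pi^i_j(b_i)=\pi^j_i(b_j)$ for all $i,j$ comes from an element of $B$. If $P$ is an algebra and a right $C$-comodule with coaction $\rho(p)=p_{(0)}\otimes p_{(1)}$, let $P^{\mathrm{co}\,C}=\{b\in P: \rho(bp)=b\rho(p)\ \forall p\in P\}$. A cleft $C$-coalgebra Galois extension $P(B')^C_\gamma$ consists of such a $P$, an identification of the algebra $B'$ with $P^{\mathrm{co}\,C}$, bijectivity of the canonical map $P\otimes_{B'}P\to P\otimes C$, $p\otimes q\mapsto pq_{(0)}\otimes q_{(1)}$, and a right $C$-colinear convolution invertible map $\gamma:C\to P$; then $p_{(0)}\gamma^{-1}(p_{(1)})\in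 B'$ for all $p\in P$. For each $i\in I$ let $P_i(B_i)^C_{\gamma_i}$, and for each unordered pair $i,j\in I$ let $P_{ij}(B_{ij})^C_{\gamma_{ij}}$ ($P_{ij}=P_{ji}$, $\gamma_{ij}=\gamma_{ji}$), be cleft $C$-coalgebra Galois extensions. Suppose that for each $i$ the element $1_{(0)}\gamma_i^{-1}(1_{(1)})\in B_i$ has a right inverse in $B_i$. Let $\chi^i_j:P_i\to P_{ij}$, $i,j\in I$, be surjective maps which are algebra maps and right $C$-colinear. (1) One has $\chi^i_j(b)=\pi^i_j(b)$ for all $i,j\in I$, $b\in B_i$ if and only if there are convolution invertible maps (gauge transformations) $\Gamma^i_j:C\to B_{ij}$, $i,j\in I$, such that for all $i,j\in I$, $p\in P_i$ $$\chi^i_j(p)=\pi^i_j\big(p_{(0)}\gamma_i^{-1}(p_{(1)})\big)\,\Gamma^i_j(p_{(2)})\,\gamma_{ij}(p_{(3)}).\qquad(*)$$ (2) Assume moreover that $C$ is flat over $\mathbb K$ and that either $N\le 3$ or, for all $1\le k<N$ and $1\le i<k$, $$\bigcap_{1\le j\le i}\big(\ker\pi^{k+1}_j+\ker\pi^{k+1}_{i+1}\big)=\Big(\bigcap_{1\le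 j\le i}\ker\pi^{k+1}_j\Big)+\ker\pi^{k+1}_{i+1}.$$ Let $\Gamma^i_j$ be convolution invertible maps satisfying $(*)$, put $\Xi_{ij}=\Gamma^i_j*(\Gamma^j_i)^{-1}:C\to B_{ij}$ (convolution product and inverse), and let $P=\{(p_i)_i\in\prod_iP_i:\chi^i_j(p_i)=\chi^j_i(p_j)\ \forall i,j\in I\}$. Then all the projections $\chi_n:P\to P_n$, $(p_i)_i\mapsto p_n$, $n\in I$, are surjective if and only if for all $i,j,k\in I$ and $c\in C$ $$\pi^{ij}_k(\Xi_{ij}(c))=\pi^{ik}_j(\Xi_{ik}(c_{(1)}))\,\pi^{kj}_i(\Xi_{kj}(c_{(2)})).$$ -/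

import Mathlib

open TensorProduct

namespace CleftGluing

section Comodule

variable (R C P : Type*) [CommRing R] [AddCommGroup C] [Module R C] [Coalgebra R C]

/-- A right comodule structure `p ↦ p₍₀₎ ⊗ p₍₁₎` over the coalgebra `C`. -/
class RightComodule [AddCommGroup P] [Module R P] where
  coact : P →ₗ[R] P ⊗[R] C
  coassoc : (TensorProduct.assoc R P C C).toLinearMap ∘ₗ coact.rTensor C ∘ₗ coact =
    (Coalgebra.comul (R := R) (A := C)).lTensor P ∘ₗ coact
  counit_coact : (TensorProduct.rid R P).toLinearMap ∘ₗ
    (Coalgebra.counit (R := R) (A := C)).lTensor P ∘ₗ coact = LinearMap.id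

/-- A coalgebra is a right comodule over itself through its comultiplication. -/
instance RightComodule.self : RightComodule R C C where
  coact := Coalgebra.comul
  coassoc := Coalgebra.coassoc
  counit_coact := by
    ext c
    simp

/-- Right `C`-colinear maps. -/
def IsColinear {M N : Type*} [AddCommGroup M] [Module R M] [AddCommGroup N] [Module R N]
    [RightComodule R C M] [RightComodule R C N] (f : M →ₗ[R] N) : Prop :=
  RightComodule.coact (C := C) ∘ₗ f = f.rTensor C ∘ₗ RightComodule.coact (R := R) (C := C) (P := M)

variable [Ring P] [Algebra R P] [RightComodule R C P]

/-- The subalgebra `P^{co C}` of those `b` with `ρ (b p) = b ρ (p)` for all `p`. -/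
def coinvariants : Subalgebra R P where
  carrier := {b | ∀ p : P, RightComodule.coact (R := R) (C := C) (b * p) =
    b • RightComodule.coact (R := R) (C := C) p}
  mul_mem' {a b} ha hb p := by rw [mul_assoc, ha, hb, mul_smul]
  add_mem' {a b} ha hb p := by rw [add_mul, map_add, ha, hb, add_smul]
  algebraMap_mem' r p := by
    rw [← Algebra.smul_def, map_smul, algebraMap_smul]

end Comodule

section Galois

variable (R C P : Type*) [CommRing R] [AddCommGroup C] [Module R C] [Coalgebra R C]
  [Ring P] [Algebra R P]

/-- The relations `p b ⊗ q = p ⊗ b q`, for `b` in a subalgebra `S`. -/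
def balancedRelations (S : Subalgebra R P) : Submodule R (P ⊗[R] P) :=
  Submodule.span R {x | ∃ p q : P, ∃ b ∈ S, x = (p * b) ⊗ₜ[R] q - p ⊗ₜ[R] (b * q)}

/-- `P ⊗_S P` for a (not necessarily commutative) subalgebra `S` of `P`. -/
abbrev BalancedTensor (S : Subalgebra R P) : Type _ := (P ⊗[R] P) ⧸ balancedRelations R P S

/-- The left multiplication `p ⊗ (q ⊗ c) ↦ p q ⊗ c`. -/
noncomputable def leftMul : P ⊗[R] (P ⊗[R] C) →ₗ[R] P ⊗[R] C :=
  (LinearMap.mul' R P).rTensor C ∘ₗ (TensorProduct.assoc R P P C).symm.toLinearMap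

variable {R C P} in
set_option linter.unusedSectionVars false in
lemma leftMul_tmul (p : P) (m : P ⊗[R] C) : leftMul R C P (p ⊗ₜ m) = p • m := by
  induction m with
  | zero => simp
  | tmul q c => simp [leftMul, TensorProduct.smul_tmul']
  | add x y hx hy => rw [tmul_add, map_add, hx, hy, smul_add]

variable [RightComodule R C P]

/-- `p ⊗ q ↦ p q₍₀₎ ⊗ q₍₁₎` on `P ⊗ P`. -/
noncomputable def preCanonicalMap : P ⊗[R] P →ₗ[R] P ⊗[R] C :=
  leftMul R C P ∘ₗ (RightComodule.coact (R := R) (C := C) (P := P)).lTensor P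

variable {R C P} in
lemma preCanonicalMap_tmul (p q : P) : preCanonicalMap R C P (p ⊗ₜ q) =
    p • RightComodule.coact (R := R) (C := C) q := by
  simp [preCanonicalMap, leftMul_tmul]

/-- The canonical map `P ⊗_{P^{co C}} P → P ⊗ C`, `p ⊗ q ↦ p q₍₀₎ ⊗ q₍₁₎`. -/
noncomputable def canonicalMap :
    BalancedTensor R P (coinvariants R C P) →ₗ[R] P ⊗[R] C :=
  (balancedRelations R P (coinvariants R C P)).liftQ (preCanonicalMap R C P) <| by
    rw [balancedRelations, Submodule.span_le]
    rintro _ ⟨p, q, b, hb, rfl⟩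
    simp only [SetLike.mem_coe, LinearMap.mem_ker, map_sub, preCanonicalMap_tmul]
    rw [hb q, mul_smul, sub_self]

/-- `p ↦ p₍₀₎ g(p₍₁₎)`. -/
noncomputable def coactMul (g : C →ₗ[R] P) : P →ₗ[R] P :=
  LinearMap.mul' R P ∘ₗ g.lTensor P ∘ₗ RightComodule.coact (R := R) (C := C) (P := P)

end Galois

/-- A cleft `C`-coalgebra Galois extension `P(B)^C_γ`: the algebra `B` is identified through
`incl` with the coinvariants of `P`, the canonical map is bijective, and `cleaving` is a right
`C`-colinear map `γ : C → P` that is invertible for the convolution product. -/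
structure CleftExtension (R C B P : Type*) [CommRing R]
    [AddCommGroup C] [Module R C] [Coalgebra R C] [Ring B] [Algebra R B]
    [Ring P] [Algebra R P] [RightComodule R C P] where
  incl : B →ₐ[R] P
  incl_injective : Function.Injective incl
  range_incl : incl.range = coinvariants R C P
  galois : Function.Bijective (canonicalMap R C P)
  cleaving : (WithConv (C →ₗ[R] P))ˣ
  cleaving_colinear : IsColinear R C cleaving.val.ofConv

section Trivialization

variable {R C P : Type*} [CommRing R] [AddCommGroup C] [Module R C] [Coalgebra R C]
  [Ring P] [Algebra R P]

lemma leftMul_conv (f g : WithConv (C →ₗ[R] P)) (h : C →ₗ[R] P ⊗[R] C) (c : C) :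
    leftMul R C P (TensorProduct.map (f * g).ofConv h (Coalgebra.comul c)) =
      leftMul R C P (TensorProduct.map f.ofConv
        (leftMul R C P ∘ₗ TensorProduct.map g.ofConv h ∘ₗ Coalgebra.comul) (Coalgebra.comul c)) := by
  have key : leftMul R C P ∘ₗ TensorProduct.map (f * g).ofConv h =
      (leftMul R C P ∘ₗ TensorProduct.map f.ofConv
        (leftMul R C P ∘ₗ TensorProduct.map g.ofConv h)) ∘ₗ
      (TensorProduct.assoc R C C C).toLinearMap ∘ₗ
        (Coalgebra.comul (R := R) (A := C)).rTensor C := by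
    ext x y
    simp only [LinearMap.convMul_def]
    simp only [AlgebraTensorModule.curry_apply, LinearMap.restrictScalars_self, curry_apply,
      LinearMap.coe_comp, Function.comp_apply, map_tmul, LinearEquiv.coe_coe,
      LinearMap.rTensor_tmul]
    induction Coalgebra.comul (R := R) x with
    | zero => simp
    | tmul a b => simp [leftMul_tmul, mul_smul]
    | add a b ha hb => simp only [map_add, add_tmul, ha, hb]
  have h1 := LinearMap.congr_fun key (Coalgebra.comul c)
  simp only [LinearMap.coe_comp, Function.comp_apply, LinearEquiv.coe_coe,
    Coalgebra.coassoc_apply] at h1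
  rw [h1]
  congr 1
  induction Coalgebra.comul (R := R) c with
  | zero => simp
  | tmul a b => simp
  | add a b ha hb => simp only [map_add, ha, hb]

lemma leftMul_one (h : C →ₗ[R] P ⊗[R] C) (c : C) :
    leftMul R C P (TensorProduct.map (1 : WithConv (C →ₗ[R] P)).ofConv h (Coalgebra.comul c)) =
      h c := by
  have key : leftMul R C P ∘ₗ TensorProduct.map (1 : WithConv (C →ₗ[R] P)).ofConv h =
      h ∘ₗ (TensorProduct.lid R C).toLinearMap ∘ₗ
        (Coalgebra.counit (R := R) (A := C)).rTensor C := by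
    ext x y
    simp [LinearMap.convOne_def, leftMul_tmul, algebraMap_smul]
  have h1 := LinearMap.congr_fun key (Coalgebra.comul c)
  simpa using h1

variable [RightComodule R C P]

/-- Right multiplication by `q` on `P ⊗_{P^{co C}} P`. -/
noncomputable def balancedMulRight (q : P) :
    BalancedTensor R P (coinvariants R C P) →ₗ[R] BalancedTensor R P (coinvariants R C P) :=
  Submodule.mapQ _ _ ((LinearMap.mulRight R q).lTensor P) <| by
    rw [balancedRelations, Submodule.span_le]
    rintro _ ⟨x, y, b, hb, rfl⟩
    refine Submodule.subset_span ⟨x, y * q, b, hb, ?_⟩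
    simp [mul_assoc]

/-- If the canonical map is bijective, right multiplication by `q` is transported to a left
`P`-linear map on `P ⊗ C` which sends `ρ(p)` to `ρ(pq)`, linearly in `q`. -/
lemma exists_entwining (hcan : Function.Bijective (canonicalMap R C P)) :
    ∃ T : (P ⊗[R] C) →ₗ[R] P →ₗ[R] (P ⊗[R] C),
      (∀ (p : P) (m : P ⊗[R] C) (q : P), T (p • m) q = p • T m q) ∧
      ∀ p q : P, T (RightComodule.coact p) q = RightComodule.coact (p * q) := by
  let e := LinearEquiv.ofBijective _ hcan
  have hmk : ∀ z : P ⊗[R] P, canonicalMap R C P (Submodule.Quotient.mk z) =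
      preCanonicalMap R C P z := fun z => rfl
  have hpre : ∀ (p q : P) (z : P ⊗[R] P),
      preCanonicalMap R C P ((LinearMap.mulRight R q).lTensor P
        ((LinearMap.mulLeft R p).rTensor P z)) =
      p • preCanonicalMap R C P ((LinearMap.mulRight R q).lTensor P z) := by
    intro p q z
    induction z with
    | zero => simp
    | tmul a b => simp [preCanonicalMap_tmul, mul_smul]
    | add a b ha hb => simp only [map_add, smul_add, ha, hb]
  have hpre0 : ∀ (p : P) (z : P ⊗[R] P),
      preCanonicalMap R C P ((LinearMap.mulLeft R p).rTensor P z) =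
      p • preCanonicalMap R C P z := by
    intro p z
    induction z with
    | zero => simp
    | tmul a b => simp [preCanonicalMap_tmul, mul_smul]
    | add a b ha hb => simp only [map_add, smul_add, ha, hb]
  have hval : ∀ (q : P) (z : P ⊗[R] P),
      canonicalMap R C P (balancedMulRight q (e.symm (preCanonicalMap R C P z))) =
        preCanonicalMap R C P ((LinearMap.mulRight R q).lTensor P z) := by
    intro q z
    have : e.symm (preCanonicalMap R C P z) = Submodule.Quotient.mk z := by
      rw [LinearEquiv.symm_apply_eq]
      rfl
    rw [this]
    rfl
  have hsurj : ∀ m : P ⊗[R] C, ∃ z, preCanonicalMap R C P z = m := by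
    intro m
    obtain ⟨y, hy⟩ := hcan.2 m
    obtain ⟨z, rfl⟩ := Submodule.Quotient.mk_surjective _ y
    exact ⟨z, hy⟩
  let T : (P ⊗[R] C) →ₗ[R] P →ₗ[R] (P ⊗[R] C) :=
    LinearMap.mk₂ R (fun m q => canonicalMap R C P (balancedMulRight q (e.symm m)))
      (fun m m' q => by simp only [map_add])
      (fun r m q => by simp only [map_smul])
      (fun m q q' => by
        obtain ⟨z, rfl⟩ := hsurj m
        simp only [hval, ← map_add]
        congr 1
        induction z with
        | zero => simp
        | tmul a b => simp [mul_add, tmul_add]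
        | add a b ha hb => simp only [map_add, ha, hb]; abel)
      (fun r m q => by
        obtain ⟨z, rfl⟩ := hsurj m
        simp only [hval, ← map_smul]
        congr 1
        induction z with
        | zero => simp
        | tmul a b => simp
        | add a b ha hb => simp only [map_add, smul_add, ha, hb])
  refine ⟨T, ?_, ?_⟩
  · intro p m q
    obtain ⟨z, rfl⟩ := hsurj m
    change canonicalMap R C P (balancedMulRight q (e.symm (p • preCanonicalMap R C P z))) =
      p • canonicalMap R C P (balancedMulRight q (e.symm (preCanonicalMap R C P z)))
    rw [← hpre0, hval, hval, hpre]
  · intro p q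
    change canonicalMap R C P (balancedMulRight q (e.symm (RightComodule.coact p))) = _
    have : RightComodule.coact p = preCanonicalMap R C P (1 ⊗ₜ p) := by
      rw [preCanonicalMap_tmul, one_smul]
    rw [this, hval]
    simp [preCanonicalMap_tmul]

/-- In a cleft coalgebra Galois extension, `p₍₀₎ γ⁻¹(p₍₁₎)` is coinvariant. -/
lemma coactMul_inv_mem (hcan : Function.Bijective (canonicalMap R C P))
    (γ : (WithConv (C →ₗ[R] P))ˣ) (hγ : IsColinear R C γ.val.ofConv) (p : P) :
    coactMul R C P (↑γ⁻¹ : WithConv (C →ₗ[R] P)).ofConv p ∈ coinvariants R C P := by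
  obtain ⟨T, hT1, hT2⟩ := exists_entwining hcan
  set δ : C →ₗ[R] P := (↑γ⁻¹ : WithConv (C →ₗ[R] P)).ofConv with hδ
  have hcol : ∀ c, RightComodule.coact (γ.val.ofConv c) =
      TensorProduct.map γ.val.ofConv LinearMap.id (Coalgebra.comul c) :=
    fun c => LinearMap.congr_fun hγ c
  intro q
  let S : (P ⊗[R] C) →ₗ[R] C →ₗ[R] (P ⊗[R] C) :=
    (T.compl₂ (LinearMap.mulRight R q ∘ₗ δ))
  let h : C →ₗ[R] P ⊗[R] C :=
    TensorProduct.lift (S ∘ₗ TensorProduct.mk R P C 1) ∘ₗ Coalgebra.comul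
  have step1 : ∀ p : P, RightComodule.coact (coactMul R C P δ p * q) =
      leftMul R C P (h.lTensor P (RightComodule.coact (C := C) p)) := by
    intro p
    have hl : ∀ z : P ⊗[R] C, RightComodule.coact (C := C)
        (LinearMap.mul' R P (δ.lTensor P z) * q) =
        TensorProduct.lift S ((RightComodule.coact (R := R) (C := C) (P := P)).rTensor C z) := by
      intro z
      induction z with
      | zero => simp
      | tmul a b => simp [S, hT2, mul_assoc]
      | add a b ha hb => simp only [map_add, add_mul, ha, hb]
    have hr : leftMul R C P ∘ₗ h.lTensor P = TensorProduct.lift S ∘ₗ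
        (TensorProduct.assoc R P C C).symm.toLinearMap ∘ₗ
          (Coalgebra.comul (R := R) (A := C)).lTensor P := by
      ext a b
      simp only [h, AlgebraTensorModule.curry_apply, LinearMap.restrictScalars_self, curry_apply,
        LinearMap.coe_comp, Function.comp_apply, LinearEquiv.coe_coe,
        LinearMap.lTensor_tmul, leftMul_tmul]
      induction Coalgebra.comul (R := R) b with
      | zero => simp
      | tmul x y =>
        simp only [lift.tmul, LinearMap.coe_comp, Function.comp_apply, mk_apply, assoc_symm_tmul,
          S, LinearMap.compl₂_apply, ← hT1, TensorProduct.smul_tmul', smul_eq_mul, mul_one]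
      | add x y hx hy => simp only [map_add, smul_add, tmul_add, hx, hy]
    have hr' := LinearMap.congr_fun hr (RightComodule.coact p)
    have hco := LinearMap.congr_fun (RightComodule.coassoc (R := R) (C := C) (P := P)) p
    simp only [LinearMap.coe_comp, Function.comp_apply, LinearEquiv.coe_coe] at hr' hco
    rw [hr', ← hco, LinearEquiv.symm_apply_apply, ← hl]
    rfl
  have step2 : ∀ c : C, coactMul R C P δ (γ.val.ofConv c) =
      algebraMap R P (Coalgebra.counit c) := by
    intro c
    have h1 := LinearMap.convMul_apply γ.val (↑γ⁻¹ : WithConv (C →ₗ[R] P)) c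
    rw [Units.mul_inv, LinearMap.convOne_apply] at h1
    rw [h1]
    simp only [coactMul, LinearMap.coe_comp, Function.comp_apply, hcol]
    congr 1
    induction Coalgebra.comul (R := R) c with
    | zero => simp
    | tmul x y => simp [hδ]
    | add x y hx hy => simp only [map_add, hx, hy]
  have step3 : leftMul R C P ∘ₗ TensorProduct.map γ.val.ofConv h ∘ₗ Coalgebra.comul =
      (LinearMap.toSpanSingleton R _ (RightComodule.coact q)) ∘ₗ Coalgebra.counit := by
    ext c
    have h1 := step1 (γ.val.ofConv c)
    rw [step2, ← Algebra.smul_def, map_smul, hcol] at h1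
    simp only [LinearMap.coe_comp, Function.comp_apply, LinearMap.toSpanSingleton_apply]
    rw [h1]
    congr 1
    induction Coalgebra.comul (R := R) c with
    | zero => simp
    | tmul x y => simp
    | add x y hx hy => simp only [map_add, hx, hy]
  have step4 : ∀ c, h c = δ c • RightComodule.coact (C := C) q := by
    intro c
    rw [← leftMul_one h c, ← Units.inv_mul γ, leftMul_conv, step3]
    have key : leftMul R C P ∘ₗ TensorProduct.map δ
        (LinearMap.toSpanSingleton R _ (RightComodule.coact q) ∘ₗ Coalgebra.counit) =
        leftMul R C P ∘ₗ (TensorProduct.mk R P (P ⊗[R] C)).flip (RightComodule.coact q) ∘ₗ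
          δ ∘ₗ (TensorProduct.rid R C).toLinearMap ∘ₗ
          (Coalgebra.counit (R := R) (A := C)).lTensor C := by
      ext x y
      simp [leftMul_tmul]
    have h1 := LinearMap.congr_fun key (Coalgebra.comul c)
    simpa [leftMul_tmul] using h1
  rw [step1]
  simp only [coactMul, LinearMap.coe_comp, Function.comp_apply]
  induction RightComodule.coact (R := R) (C := C) p with
  | zero => simp
  | tmul x y => simp [leftMul_tmul, step4, mul_smul]
  | add x y hx hy => simp only [map_add, add_smul, hx, hy]

variable {B : Type*} [Ring B] [Algebra R B]

/-- The map `P → B`, `p ↦ p₍₀₎ γ⁻¹(p₍₁₎)`, of a cleft extension `P(B)^C_γ`. -/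
noncomputable def CleftExtension.base (E : CleftExtension R C B P) : P →ₗ[R] B :=
  (LinearEquiv.ofInjective E.incl.toLinearMap E.incl_injective).symm.toLinearMap ∘ₗ
    (coactMul R C P (↑E.cleaving⁻¹ : WithConv (C →ₗ[R] P)).ofConv).codRestrict
      (LinearMap.range E.incl.toLinearMap) (fun p => by
        have h := coactMul_inv_mem E.galois E.cleaving E.cleaving_colinear p
        rw [← E.range_incl] at h
        exact h)

lemma CleftExtension.incl_base (E : CleftExtension R C B P) (p : P) :
    E.incl (E.base p) = coactMul R C P (↑E.cleaving⁻¹ : WithConv (C →ₗ[R] P)).ofConv p := by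
  have h := LinearEquiv.apply_symm_apply
    (LinearEquiv.ofInjective E.incl.toLinearMap E.incl_injective)
    ((coactMul R C P (↑E.cleaving⁻¹ : WithConv (C →ₗ[R] P)).ofConv).codRestrict
      (LinearMap.range E.incl.toLinearMap) (fun p => by
        have h := coactMul_inv_mem E.galois E.cleaving E.cleaving_colinear p
        rw [← E.range_incl] at h
        exact h) p)
  exact congrArg Subtype.val h

/-- The map `p ↦ f(p₍₀₎ γ⁻¹(p₍₁₎)) Γ(p₍₂₎) γ'(p₍₃₎)` between cleft extensions `P(B)^C_γ` and
`P'(B')^C_γ'`, for an algebra map `f : B → B'` and a gauge transformation `Γ : C → B'`. -/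
noncomputable def gaugeMap {B' P' : Type*} [Ring B'] [Algebra R B'] [Ring P'] [Algebra R P']
    [RightComodule R C P'] (E : CleftExtension R C B P) (E' : CleftExtension R C B' P')
    (f : B →ₐ[R] B') (Γ : WithConv (C →ₗ[R] B')) : P →ₗ[R] P' :=
  LinearMap.mul' R P' ∘ₗ
    TensorProduct.map (E'.incl.toLinearMap ∘ₗ f.toLinearMap ∘ₗ E.base)
      (WithConv.toConv (E'.incl.toLinearMap ∘ₗ Γ.ofConv) * E'.cleaving.val).ofConv ∘ₗ
    RightComodule.coact (R := R) (C := C) (P := P)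

end Trivialization

section Covering

variable {R B : Type*} [CommRing R] [Ring B] [Algebra R B] {I : Type*}

instance isTwoSided_sup (J K : Ideal B) [J.IsTwoSided] [K.IsTwoSided] : (J ⊔ K).IsTwoSided :=
  ⟨fun b ha => by
    obtain ⟨x, hx, y, hy, rfl⟩ := Submodule.mem_sup.1 ha
    rw [add_mul]
    exact Submodule.add_mem_sup (J.mul_mem_right b hx) (K.mul_mem_right b hy)⟩

/-- The ideal `K_i + K_j` of an unordered pair `{i, j}` of indices (possibly `i = j`). -/
def pairIdeal (K : I → Ideal B) : Sym2 I → Ideal B :=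
  Sym2.lift ⟨fun i j => K i ⊔ K j, fun i j => sup_comm (K i) (K j)⟩

instance (K : I → Ideal B) [∀ i, (K i).IsTwoSided] (e : Sym2 I) :
    (pairIdeal K e).IsTwoSided := by
  induction e with
  | _ i j => exact isTwoSided_sup (K i) (K j)

lemma le_pairIdeal (K : I → Ideal B) {e : Sym2 I} {i : I} (hi : i ∈ e) :
    K i ≤ pairIdeal K e := by
  obtain ⟨j, rfl⟩ := hi
  exact le_sup_left

lemma pairIdeal_le (K : I → Ideal B) {i j : I} {J : Ideal B} (hi : K i ≤ J) (hj : K j ≤ J) :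
    pairIdeal K s(i, j) ≤ J :=
  sup_le hi hj

variable (R) (K : I → Ideal B) [∀ i, (K i).IsTwoSided]

/-- The surjection `π^i_j : B_i → B_{ij}`, where `e = {i, j}` and `B_{ij} = B / (K_i + K_j)`. -/
abbrev piPair (e : Sym2 I) (i : I) (hi : i ∈ e) : B ⧸ K i →ₐ[R] B ⧸ pairIdeal K e :=
  Ideal.Quotient.factorₐ R (le_pairIdeal K hi)

/-- `ker π^i_j`, an ideal of `B_i`. -/
abbrev kerPi (i j : I) : Ideal (B ⧸ K i) :=
  RingHom.ker (piPair R K s(i, j) i (Sym2.mem_mk_left i j))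

/-- `(K_i)` is a complete covering of `B`: the ideals intersect in zero, and every family
`b_i ∈ B_i` with `π^i_j(b_i) = π^j_i(b_j)` for all `i, j` comes from an element of `B`. -/
def IsCompleteCovering : Prop :=
  (⨅ i, K i) = ⊥ ∧
    ∀ b : (∀ i, B ⧸ K i),
      (∀ (e : Sym2 I) (i j : I) (hi : i ∈ e) (hj : j ∈ e),
        piPair R K e i hi (b i) = piPair R K e j hj (b j)) →
      ∃ x : B, ∀ i, Ideal.Quotient.mk (K i) x = b i

end Covering

section Gluing

variable {R : Type*} [CommRing R] {I : Type*} {P : I → Type*} {Q : Sym2 I → Type*}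
  [∀ i, Ring (P i)] [∀ i, Algebra R (P i)] [∀ e, Ring (Q e)] [∀ e, Algebra R (Q e)]

/-- The gluing of the algebras `P_i` along the maps `χ^i_j : P_i → P_{ij}`: families `(p_i)` with
`χ^i_j(p_i) = χ^j_i(p_j)` for all `i, j`. Here `χ e i hi` is `χ^i_j` for `e = {i, j}`. -/
def gluing (χ : ∀ (e : Sym2 I) (i : I), i ∈ e → (P i →ₐ[R] Q e)) : Subalgebra R (∀ i, P i) where
  carrier := {p | ∀ (e : Sym2 I) (i j : I) (hi : i ∈ e) (hj : j ∈ e),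
    χ e i hi (p i) = χ e j hj (p j)}
  mul_mem' {a b} ha hb e i j hi hj := by simp [ha e i j hi hj, hb e i j hi hj]
  add_mem' {a b} ha hb e i j hi hj := by simp [ha e i j hi hj, hb e i j hi hj]
  algebraMap_mem' r e i j hi hj := by simp [Pi.algebraMap_apply]

/-- The projection `χ_n` of the gluing to `P_n`. -/
def gluingProj (χ : ∀ (e : Sym2 I) (i : I), i ∈ e → (P i →ₐ[R] Q e)) (n : I) :
    gluing χ →ₐ[R] P n :=
  (Pi.evalAlgHom R P n).comp (gluing χ).val

end Gluing

section Transition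

variable {R C B : Type*} [CommRing R] [AddCommGroup C] [Module R C] [Coalgebra R C]
  [Ring B] [Algebra R B] {I : Type*} (K : I → Ideal B) [∀ i, (K i).IsTwoSided]

/-- A family of gauge transformations: `Γ e i hi` is the convolution invertible map
`Γ^i_j : C → B_{ij}`, where `e = {i, j}`. -/
abbrev GaugeFamily (R C : Type*) [CommRing R] [AddCommGroup C] [Module R C] [Coalgebra R C]
    [Algebra R B] : Type _ :=
  ∀ (e : Sym2 I) (i : I), i ∈ e → (WithConv (C →ₗ[R] B ⧸ pairIdeal K e))ˣ

variable {K}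

/-- `Ξ_{ij} = Γ^i_j * (Γ^j_i)⁻¹ : C → B_{ij}`. -/
noncomputable def Xi (Γ : GaugeFamily K R C) (i j : I) :
    (WithConv (C →ₗ[R] B ⧸ pairIdeal K s(i, j)))ˣ :=
  Γ s(i, j) i (Sym2.mem_mk_left i j) * (Γ s(i, j) j (Sym2.mem_mk_right i j))⁻¹

/-- `C → B_{ij} → B_{ijk} = B / (K_i + K_j + K_k)`, with values in `B / J` for `J ⊇ K_i + K_j`. -/
noncomputable def pushXi (Γ : GaugeFamily K R C) (i j : I) (J : Ideal B) [J.IsTwoSided]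
    (hi : K i ≤ J) (hj : K j ≤ J) : WithConv (C →ₗ[R] B ⧸ J) :=
  WithConv.toConv ((Ideal.Quotient.factorₐ R (pairIdeal_le K hi hj)).toLinearMap ∘ₗ
    (Xi Γ i j).val.ofConv)

/-- The cocycle condition `π^{ij}_k(Ξ_{ij}) = π^{ik}_j(Ξ_{ik}) * π^{kj}_i(Ξ_{kj})` for all
`i, j, k`, where `*` is the convolution product of maps `C → B_{ijk} = B / (K_i + K_j + K_k)`. -/
def IsCocycle (Γ : GaugeFamily K R C) : Prop :=
  ∀ i j k : I,
    pushXi Γ i j (K i ⊔ K j ⊔ K k) (le_sup_left.trans le_sup_left)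
        (le_sup_right.trans le_sup_left) =
      pushXi Γ i k (K i ⊔ K j ⊔ K k) (le_sup_left.trans le_sup_left) le_sup_right *
        pushXi Γ k j (K i ⊔ K j ⊔ K k) le_sup_right (le_sup_right.trans le_sup_left)

end Transition

end CleftGluing

open CleftGluing

namespace CleftGluing

section ScalarExtension

variable {R C A A' : Type*} [CommRing R] [AddCommGroup C] [Module R C]
  [Ring A] [Algebra R A] [Ring A'] [Algebra R A']

/-! A cleaving trivializes its extension as a left `B`-module: `b ⊗ c ↦ b γ(c)` is a bijection `B ⊗
C → P` with inverse `p ↦ p₍₀₎ γ⁻¹(p₍₁₎) ⊗ p₍₂₎` (`triv_untriv`, `untriv_triv`). In these coordinates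
the right-hand side of (*) is reduction of the base ring along `π^i_j` followed by the left linear
map `1 ⊗ c ↦ Γ(c₍₁₎) ⊗ c₍₂₎` (`gaugeMap_triv`). Such twists compose by convolution in reversed order
and determine `Γ` (`twist_mul`, `twist_injective`).

Part (1): if `χ` restricts to `π` on the base, then `δ = χ ∘ γ_i` is a second cleaving of `P_{ij}`,
and two cleavings of one extension differ by a gauge transformation, here `Γ = δ * γ_{ij}⁻¹`
(`exists_gauge`). Conversely (*) makes `χ` left linear over `π`, and `χ` is unital.

Part (2) becomes a statement about families `x_i ∈ B_i ⊗ C` that match over the `B_{ij}`. Over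
`B_{ijk}`, matching says that `x_j` is the twist of `x_i` by `Ξ_{ij}`. If every element is a member
of a matching family, passing from `i` to `j` directly or through `k` gives the same result, whence
the cocycle condition (`isCocycle_of_matches`). Conversely, under the cocycle condition a matching
family on the indices below `m` extends to `m`: the requirements at `m` are pairwise compatible
congruences, solved by a Chinese remainder argument (`exists_crt`). Prescribing a value at `m`
itself needs the reverse passage, to smaller indices; there the values that do occur form a left
submodule, which is shown to be everything by successive approximation (`mem_of_extIdeal`). Flatness
of `C` serves to make `J ↦ J ⊗ C` commute with finite intersections. -/

lemma rTensor_algHom_smul (f : A →ₐ[R] A') (a : A) (z : A ⊗[R] C) :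
    f.toLinearMap.rTensor C (a • z) = f a • f.toLinearMap.rTensor C z := by
  induction z with
  | zero => simp
  | tmul b c => simp [TensorProduct.smul_tmul']
  | add x y hx hy => simp only [smul_add, map_add, hx, hy]

end ScalarExtension

/-! ### Convolution algebras and twists of `A ⊗ C` -/

section Convolution

variable {R C A A' : Type*} [CommRing R] [AddCommGroup C] [Module R C] [Coalgebra R C]
  [Ring A] [Algebra R A] [Ring A'] [Algebra R A']

/-- Composition with an algebra map, as a homomorphism of convolution algebras. -/
noncomputable def convMap (f : A →ₐ[R] A') :
    WithConv (C →ₗ[R] A) →* WithConv (C →ₗ[R] A') where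
  toFun g := WithConv.toConv (f.toLinearMap ∘ₗ g.ofConv)
  map_one' := by
    ext c
    simp
  map_mul' g h := by
    ext c
    have key : f.toLinearMap ∘ₗ LinearMap.mul' R A ∘ₗ TensorProduct.map g.ofConv h.ofConv =
        LinearMap.mul' R A' ∘ₗ
          TensorProduct.map (f.toLinearMap ∘ₗ g.ofConv) (f.toLinearMap ∘ₗ h.ofConv) := by
      ext x y
      simp
    exact LinearMap.congr_fun key (Coalgebra.comul c)

lemma convMap_injective {f : A →ₐ[R] A'} (hf : Function.Injective f) :
    Function.Injective (convMap (C := C) f) := by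
  intro g h hgh
  ext c
  exact hf (LinearMap.congr_fun (congrArg WithConv.ofConv hgh) c)

/-- The left `A`-linear endomorphism `a ⊗ c ↦ a f(c₍₁₎) ⊗ c₍₂₎` of `A ⊗ C`. -/
noncomputable def twist (f : WithConv (C →ₗ[R] A)) : A ⊗[R] C →ₗ[R] A ⊗[R] C :=
  leftMul R C A ∘ₗ (TensorProduct.map f.ofConv LinearMap.id ∘ₗ Coalgebra.comul).lTensor A

lemma twist_tmul (f : WithConv (C →ₗ[R] A)) (a : A) (c : C) :
    twist f (a ⊗ₜ c) = a • TensorProduct.map f.ofConv LinearMap.id (Coalgebra.comul c) := by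
  simp [twist, leftMul_tmul]

lemma twist_smul (f : WithConv (C →ₗ[R] A)) (a : A) (z : A ⊗[R] C) :
    twist f (a • z) = a • twist f z := by
  induction z with
  | zero => simp
  | tmul b c => rw [TensorProduct.smul_tmul', twist_tmul, twist_tmul, smul_eq_mul, mul_smul]
  | add x y hx hy => simp only [smul_add, map_add, hx, hy]

lemma leftMul_map_one_tmul (f : WithConv (C →ₗ[R] A)) (z : C ⊗[R] C) :
    leftMul R C A (TensorProduct.map f.ofConv (TensorProduct.mk R A C 1) z) =
      TensorProduct.map f.ofConv LinearMap.id z := by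
  induction z with
  | zero => simp
  | tmul x y => simp [leftMul_tmul, TensorProduct.smul_tmul']
  | add x y hx hy => simp only [map_add, hx, hy]

lemma twist_map (f g : WithConv (C →ₗ[R] A)) (z : C ⊗[R] C) :
    twist g (TensorProduct.map f.ofConv LinearMap.id z) = leftMul R C A (TensorProduct.map f.ofConv
      (TensorProduct.map g.ofConv LinearMap.id ∘ₗ Coalgebra.comul) z) := by
  induction z with
  | zero => simp
  | tmul x y => simp [twist_tmul, leftMul_tmul]
  | add x y hx hy => simp only [map_add, hx, hy]

/-- Coassociativity. The order reverses because twists are left `A`-linear: the values of `f` pass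
out to the left of `twist g`. -/
lemma twist_mul (f g : WithConv (C →ₗ[R] A)) (z : A ⊗[R] C) :
    twist (f * g) z = twist g (twist f z) := by
  induction z with
  | zero => simp
  | tmul a c =>
    rw [twist_tmul, twist_tmul, twist_smul, twist_map, ← leftMul_map_one_tmul, leftMul_conv]
    congr 4
    ext c
    exact leftMul_map_one_tmul _ _
  | add x y hx hy => simp only [map_add, hx, hy]

lemma twist_one (z : A ⊗[R] C) : twist (1 : WithConv (C →ₗ[R] A)) z = z := by
  induction z with
  | zero => simp
  | tmul a c =>
    rw [twist_tmul, ← leftMul_map_one_tmul, leftMul_one]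
    simp [TensorProduct.smul_tmul']
  | add x y hx hy => simp only [map_add, hx, hy]

lemma rTensor_twist (f : A →ₐ[R] A') (g : WithConv (C →ₗ[R] A)) (z : A ⊗[R] C) :
    f.toLinearMap.rTensor C (twist g z) = twist (convMap f g) (f.toLinearMap.rTensor C z) := by
  induction z with
  | zero => simp
  | tmul a c =>
    rw [twist_tmul, rTensor_algHom_smul, LinearMap.rTensor_tmul, twist_tmul]
    congr 1
    rw [← LinearMap.comp_apply, LinearMap.rTensor_comp_map]
    rfl
  | add x y hx hy => simp only [map_add, hx, hy]

/-- Applying the counit to the second factor of `twist f (1 ⊗ c)` recovers `f c`. -/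
lemma twist_injective : Function.Injective (twist (R := R) (C := C) (A := A)) := by
  intro f g h
  have key : ∀ f : WithConv (C →ₗ[R] A), ∀ c : C,
      TensorProduct.rid R A ((Coalgebra.counit (R := R) (A := C)).lTensor A
        (twist f (1 ⊗ₜ c))) = f.ofConv c := by
    intro f c
    have h1 : (TensorProduct.rid R A).toLinearMap ∘ₗ
        (Coalgebra.counit (R := R) (A := C)).lTensor A ∘ₗ TensorProduct.map f.ofConv LinearMap.id =
        f.ofConv ∘ₗ (TensorProduct.rid R C).toLinearMap ∘ₗ
          (Coalgebra.counit (R := R) (A := C)).lTensor C := by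
      ext x y
      simp
    have h2 := LinearMap.congr_fun h1 (Coalgebra.comul c)
    rw [twist_tmul, one_smul]
    simpa using h2
  ext c
  rw [← key f, h, key]

end Convolution

/-! ### Trivialization of cleft extensions, gauge transformations -/

section Cleft

variable {R C B P : Type*} [CommRing R] [AddCommGroup C] [Module R C] [Coalgebra R C]
  [Ring B] [Algebra R B] [Ring P] [Algebra R P] [RightComodule R C P]

/-- Coassociativity of the coaction. It allows convolution inverses to be cancelled inside
expressions `p₍₀₎ g(p₍₁₎) h(p₍₂₎)`. -/
lemma coactMul_mul (g h : WithConv (C →ₗ[R] P)) (p : P) :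
    coactMul R C P (g * h).ofConv p =
      LinearMap.mul' R P (TensorProduct.map (coactMul R C P g.ofConv) h.ofConv
        (RightComodule.coact (C := C) p)) := by
  have key1 : LinearMap.mul' R P ∘ₗ TensorProduct.map (coactMul R C P g.ofConv) h.ofConv =
      (LinearMap.mul' R P ∘ₗ (LinearMap.mul' R P ∘ₗ
        TensorProduct.map g.ofConv h.ofConv).lTensor P) ∘ₗ
      (TensorProduct.assoc R P C C).toLinearMap ∘ₗ
        (RightComodule.coact (R := R) (C := C) (P := P)).rTensor C := by
    ext x y
    simp only [coactMul, AlgebraTensorModule.curry_apply, LinearMap.restrictScalars_self,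
      curry_apply, LinearMap.coe_comp, Function.comp_apply, map_tmul, LinearEquiv.coe_coe,
      LinearMap.rTensor_tmul]
    induction RightComodule.coact (R := R) (C := C) x with
    | zero => simp
    | tmul a b => simp [mul_assoc]
    | add a b ha hb => simp only [map_add, add_tmul, ha, hb]
  have key2 : coactMul R C P (g * h).ofConv = (LinearMap.mul' R P ∘ₗ (LinearMap.mul' R P ∘ₗ
        TensorProduct.map g.ofConv h.ofConv).lTensor P) ∘ₗ
      (Coalgebra.comul (R := R) (A := C)).lTensor P ∘ₗ RightComodule.coact := by
    rw [coactMul, LinearMap.convMul_def]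
    ext x
    simp only [LinearMap.coe_comp, Function.comp_apply, ← LinearMap.lTensor_comp_apply]
    rfl
  rw [key2, ← RightComodule.coassoc]
  exact (LinearMap.congr_fun key1 (RightComodule.coact p)).symm

lemma coactMul_one (p : P) : coactMul R C P (1 : WithConv (C →ₗ[R] P)).ofConv p = p := by
  have key : LinearMap.mul' R P ∘ₗ (1 : WithConv (C →ₗ[R] P)).ofConv.lTensor P =
      (TensorProduct.rid R P).toLinearMap ∘ₗ
        (Coalgebra.counit (R := R) (A := C)).lTensor P := by
    ext x c
    simp [Algebra.smul_def, Algebra.commutes]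
  have h1 := LinearMap.congr_fun key (RightComodule.coact p)
  have h2 := LinearMap.congr_fun (RightComodule.counit_coact (R := R) (C := C) (P := P)) p
  exact h1.trans h2

lemma coactMul_colinear (g h : WithConv (C →ₗ[R] P)) (hg : IsColinear R C g.ofConv) (c : C) :
    coactMul R C P h.ofConv (g.ofConv c) = (g * h).ofConv c := by
  have hcol : RightComodule.coact (g.ofConv c) = g.ofConv.rTensor C (Coalgebra.comul c) :=
    LinearMap.congr_fun hg c
  rw [LinearMap.convMul_apply, coactMul, LinearMap.comp_apply, LinearMap.comp_apply, hcol,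
    ← LinearMap.comp_apply (LinearMap.lTensor _ _), LinearMap.lTensor_comp_rTensor]

namespace CleftExtension

variable (E : CleftExtension R C B P)

lemma coact_incl_mul (b : B) (p : P) :
    RightComodule.coact (R := R) (C := C) (E.incl b * p) =
      E.incl b • RightComodule.coact (R := R) (C := C) p := by
  have h : E.incl b ∈ coinvariants R C P := by
    rw [← E.range_incl]
    exact ⟨b, rfl⟩
  exact h p

lemma base_incl_mul (b : B) (p : P) : E.base (E.incl b * p) = b * E.base p := by
  apply E.incl_injective
  rw [map_mul E.incl, incl_base, incl_base, coactMul, LinearMap.comp_apply, LinearMap.comp_apply,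
    coact_incl_mul, LinearMap.comp_apply, LinearMap.comp_apply]
  induction RightComodule.coact (R := R) (C := C) p with
  | zero => simp
  | tmul x y => simp [TensorProduct.smul_tmul', mul_assoc]
  | add x y hx hy => simp only [smul_add, map_add, mul_add, hx, hy]

lemma base_cleaving (c : C) :
    E.base (E.cleaving.val.ofConv c) = algebraMap R B (Coalgebra.counit c) := by
  apply E.incl_injective
  rw [incl_base, coactMul_colinear _ _ E.cleaving_colinear, Units.mul_inv, LinearMap.convOne_apply,
    AlgHom.commutes]

/-- The map `B ⊗ C → P`, `b ⊗ c ↦ b γ(c)`. -/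
noncomputable def triv : B ⊗[R] C →ₗ[R] P :=
  LinearMap.mul' R P ∘ₗ TensorProduct.map E.incl.toLinearMap E.cleaving.val.ofConv

lemma triv_tmul (b : B) (c : C) : E.triv (b ⊗ₜ c) = E.incl b * E.cleaving.val.ofConv c := by
  simp [triv]

lemma triv_smul (b : B) (z : B ⊗[R] C) : E.triv (b • z) = E.incl b * E.triv z := by
  induction z with
  | zero => simp
  | tmul a c => simp [triv_tmul, mul_assoc, TensorProduct.smul_tmul']
  | add x y hx hy => simp only [smul_add, map_add, mul_add, hx, hy]

/-- The map `P → B ⊗ C`, `p ↦ p₍₀₎ γ⁻¹(p₍₁₎) ⊗ p₍₂₎`. -/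
noncomputable def untriv : P →ₗ[R] B ⊗[R] C :=
  E.base.rTensor C ∘ₗ RightComodule.coact

/-- The composite is `p₍₀₎ γ⁻¹(p₍₁₎) γ(p₍₂₎)`, and `γ⁻¹ * γ = 1`. -/
lemma triv_untriv (p : P) : E.triv (E.untriv p) = p := by
  have h : E.incl.toLinearMap ∘ₗ E.base =
      coactMul R C P (↑E.cleaving⁻¹ : WithConv (C →ₗ[R] P)).ofConv :=
    LinearMap.ext E.incl_base
  rw [triv, untriv, LinearMap.comp_apply, LinearMap.comp_apply,
    ← LinearMap.comp_apply (TensorProduct.map _ _), LinearMap.map_comp_rTensor, h, ← coactMul_mul,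
    Units.inv_mul, coactMul_one]

lemma untriv_incl_mul (b : B) (p : P) : E.untriv (E.incl b * p) = b • E.untriv p := by
  rw [untriv, LinearMap.comp_apply, coact_incl_mul, LinearMap.comp_apply]
  induction RightComodule.coact (R := R) (C := C) p with
  | zero => simp
  | tmul x y => simp [TensorProduct.smul_tmul', base_incl_mul]
  | add x y hx hy => simp only [smul_add, map_add, hx, hy]

/-- By left `B`-linearity only `1 ⊗ c` matters. Colinearity of `γ` and `base_cleaving` turn it into
`ε(c₍₁₎) ⊗ c₍₂₎`. -/
lemma untriv_triv (z : B ⊗[R] C) : E.untriv (E.triv z) = z := by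
  induction z with
  | zero => simp
  | tmul b c =>
    have hcol : RightComodule.coact (E.cleaving.val.ofConv c) =
        E.cleaving.val.ofConv.rTensor C (Coalgebra.comul c) :=
      LinearMap.congr_fun E.cleaving_colinear c
    have key : E.base.rTensor C ∘ₗ E.cleaving.val.ofConv.rTensor C =
        (TensorProduct.map (Algebra.linearMap R B) LinearMap.id) ∘ₗ
          (Coalgebra.counit (R := R) (A := C)).rTensor C := by
      ext x y
      simp [base_cleaving]
    have h := LinearMap.congr_fun key (Coalgebra.comul c)
    rw [triv_tmul, untriv_incl_mul, untriv, LinearMap.comp_apply, hcol]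
    rw [LinearMap.comp_apply] at h
    rw [h, LinearMap.comp_apply, Coalgebra.rTensor_counit_comul]
    simp [TensorProduct.smul_tmul']
  | add x y hx hy => simp only [map_add, hx, hy]

lemma triv_injective : Function.Injective E.triv :=
  Function.LeftInverse.injective E.untriv_triv

lemma triv_surjective : Function.Surjective E.triv :=
  Function.RightInverse.surjective E.triv_untriv

/-- The cleft extension with another cleaving map. -/
noncomputable def withCleaving (γ : (WithConv (C →ₗ[R] P))ˣ) (hγ : IsColinear R C γ.val.ofConv) :
    CleftExtension R C B P :=
  { E with cleaving := γ, cleaving_colinear := hγ }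

/-- `base` applied to a colinear map `C → P`. -/
noncomputable def convBase (g : WithConv (C →ₗ[R] P)) : WithConv (C →ₗ[R] B) :=
  WithConv.toConv (E.base ∘ₗ g.ofConv)

lemma convMap_convBase (g : WithConv (C →ₗ[R] P)) (hg : IsColinear R C g.ofConv) :
    convMap E.incl (E.convBase g) = g * (↑E.cleaving⁻¹ : WithConv (C →ₗ[R] P)) := by
  ext c
  exact (E.incl_base _).trans (coactMul_colinear _ _ hg c)

end CleftExtension

variable {B' P' : Type*} [Ring B'] [Algebra R B'] [Ring P'] [Algebra R P'] [RightComodule R C P']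
  (E : CleftExtension R C B P) (E' : CleftExtension R C B' P') (f : B →ₐ[R] B')

lemma gaugeMap_eq (Γ : WithConv (C →ₗ[R] B')) (p : P) :
    gaugeMap E E' f Γ p = LinearMap.mul' R P' (TensorProduct.map (E'.incl.toLinearMap ∘ₗ
      f.toLinearMap) (convMap E'.incl Γ * E'.cleaving.val).ofConv (E.untriv p)) := by
  rw [CleftExtension.untriv, LinearMap.comp_apply, ← LinearMap.comp_apply (TensorProduct.map _ _),
    LinearMap.map_comp_rTensor]
  rfl

lemma gaugeMap_incl_mul (Γ : WithConv (C →ₗ[R] B')) (b : B) (p : P) :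
    gaugeMap E E' f Γ (E.incl b * p) = E'.incl (f b) * gaugeMap E E' f Γ p := by
  rw [gaugeMap_eq, gaugeMap_eq, E.untriv_incl_mul]
  induction E.untriv p with
  | zero => simp
  | tmul x y => simp [TensorProduct.smul_tmul', mul_assoc]
  | add x y hx hy => simp only [smul_add, map_add, mul_add, hx, hy]

lemma gaugeMap_triv_tmul (Γ : WithConv (C →ₗ[R] B')) (b : B) (c : C) :
    gaugeMap E E' f Γ (E.triv (b ⊗ₜ c)) =
      E'.incl (f b) * (convMap E'.incl Γ * E'.cleaving.val).ofConv c := by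
  rw [gaugeMap_eq, E.untriv_triv]
  simp

/-- In the trivializations `B ⊗ C ≃ P`, the map `gaugeMap` is a twist. -/
lemma gaugeMap_triv (Γ : WithConv (C →ₗ[R] B')) (z : B ⊗[R] C) :
    gaugeMap E E' f Γ (E.triv z) = E'.triv (twist Γ (f.toLinearMap.rTensor C z)) := by
  induction z with
  | zero => simp
  | tmul b c =>
    rw [gaugeMap_triv_tmul, LinearMap.rTensor_tmul, twist_tmul, E'.triv_smul,
      LinearMap.convMul_apply]
    congr 1
    rw [CleftExtension.triv, LinearMap.comp_apply, TensorProduct.map_map]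
    rfl
  | add x y hx hy => simp only [map_add, hx, hy]

lemma IsColinear.comp {M M' M'' : Type*} [AddCommGroup M] [Module R M] [AddCommGroup M']
    [Module R M'] [AddCommGroup M''] [Module R M''] [RightComodule R C M] [RightComodule R C M']
    [RightComodule R C M''] {g : M' →ₗ[R] M''} {h : M →ₗ[R] M'} (hg : IsColinear R C g)
    (hh : IsColinear R C h) : IsColinear R C (g ∘ₗ h) := by
  unfold IsColinear at *
  rw [← LinearMap.comp_assoc, hg, LinearMap.comp_assoc, hh, ← LinearMap.comp_assoc,
    LinearMap.rTensor_comp]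

/-- A colinear algebra map which restricts to `f` on the base is given by a gauge
transformation. -/
lemma exists_gauge (χ : P →ₐ[R] P') (hχ : IsColinear R C χ.toLinearMap)
    (hf : ∀ b, χ (E.incl b) = E'.incl (f b)) :
    ∃ Γ : (WithConv (C →ₗ[R] B'))ˣ, ∀ p, χ p = gaugeMap E E' f Γ.val p := by
  let δ : (WithConv (C →ₗ[R] P'))ˣ := Units.map (convMap χ) E.cleaving
  have hδ : IsColinear R C δ.val.ofConv := hχ.comp E.cleaving_colinear
  have h1 := E'.convMap_convBase δ.val hδ
  have h2 : convMap E'.incl ((E'.withCleaving δ hδ).convBase E'.cleaving.val) =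
      E'.cleaving.val * (↑δ⁻¹ : WithConv (C →ₗ[R] P')) :=
    (E'.withCleaving δ hδ).convMap_convBase E'.cleaving.val E'.cleaving_colinear
  -- `Γ = δ * γ'⁻¹` has inverse `γ' * δ⁻¹`. The latter is `B'`-valued because `δ` is itself a
  -- cleaving of the same extension, so the roles of `γ'` and `δ` can be exchanged. Both identities
  -- are checked in `P'`, where `incl` is injective.
  refine ⟨⟨E'.convBase δ.val, (E'.withCleaving δ hδ).convBase E'.cleaving.val, ?_, ?_⟩, ?_⟩
  · apply convMap_injective E'.incl_injective
    rw [map_mul, h1, h2, map_one, mul_assoc, Units.inv_mul_cancel_left, Units.mul_inv]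
  · apply convMap_injective E'.incl_injective
    rw [map_mul, h1, h2, map_one, mul_assoc, Units.inv_mul_cancel_left, Units.mul_inv]
  · intro p
    obtain ⟨z, rfl⟩ := E.triv_surjective p
    induction z with
    | zero => simp
    | tmul b c =>
      rw [gaugeMap_triv_tmul, h1, mul_assoc, Units.inv_mul, mul_one, E.triv_tmul, map_mul, hf]
      rfl
    | add x y hx hy => simp only [map_add, hx, hy]

/-- Write `b = b · 1`: the gauge formula is left linear over `f`, and its value at `1` is `χ 1 = 1`.
-/
lemma map_incl_of_eq_gaugeMap (χ : P →ₐ[R] P') (Γ : WithConv (C →ₗ[R] B'))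
    (h : ∀ p, χ p = gaugeMap E E' f Γ p) (b : B) : χ (E.incl b) = E'.incl (f b) := by
  rw [← mul_one (E.incl b), h, gaugeMap_incl_mul, ← h, map_one, mul_one]

end Cleft

/-! ### Ideals extended to `A ⊗ C`: intersections, Chinese remainders, approximation -/

lemma mem_range_rTensor_inf {R C V : Type*} [CommRing R] [AddCommGroup C] [Module R C]
    [AddCommGroup V] [Module R V] [Module.Flat R C] {S T : Submodule R V} {z : V ⊗[R] C}
    (hS : z ∈ LinearMap.range (S.subtype.rTensor C))
    (hT : z ∈ LinearMap.range (T.subtype.rTensor C)) :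
    z ∈ LinearMap.range ((S ⊓ T).subtype.rTensor C) := by
  obtain ⟨w, rfl⟩ := hS
  -- `S ⊓ T` is the kernel of `S → V / T`, and a flat module preserves this exactness.
  let q : S →ₗ[R] V ⧸ T := T.mkQ ∘ₗ S.subtype
  have hex : Function.Exact (LinearMap.ker q).subtype q := fun a => by simp
  have h0 : q.rTensor C w = 0 := by
    obtain ⟨w', hw'⟩ := hT
    have : T.mkQ ∘ₗ T.subtype = 0 := by
      ext a
      simp
    rw [LinearMap.rTensor_comp, LinearMap.comp_apply, ← hw', ← LinearMap.comp_apply,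
      ← LinearMap.rTensor_comp, this, LinearMap.rTensor_zero, LinearMap.zero_apply]
  obtain ⟨v, rfl⟩ := (Module.Flat.rTensor_exact C hex w).1 h0
  let ι : LinearMap.ker q →ₗ[R] (S ⊓ T : Submodule R V) :=
    (S.subtype ∘ₗ (LinearMap.ker q).subtype).codRestrict (S ⊓ T) fun a =>
      ⟨a.1.2, (Submodule.Quotient.mk_eq_zero T).1 (LinearMap.mem_ker.1 a.2)⟩
  refine ⟨ι.rTensor C v, ?_⟩
  rw [← LinearMap.comp_apply, ← LinearMap.rTensor_comp, ← LinearMap.comp_apply,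
    ← LinearMap.rTensor_comp]
  rfl

section ExtendedIdeal

variable {R A : Type*} (C : Type*) [CommRing R] [AddCommGroup C] [Module R C] [Ring A] [Algebra R A]

/-- The image of `J ⊗ C` in `A ⊗ C`, for a left ideal `J` of `A`. -/
def extIdeal (J : Ideal A) : Submodule R (A ⊗[R] C) :=
  LinearMap.range ((J.restrictScalars R).subtype.rTensor C)

variable {C}

lemma tmul_mem_extIdeal {J : Ideal A} {a : A} (ha : a ∈ J) (c : C) :
    a ⊗ₜ[R] c ∈ extIdeal (R := R) C J :=
  ⟨(⟨a, ha⟩ : J.restrictScalars R) ⊗ₜ c, by simp⟩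

lemma extIdeal_induction {J : Ideal A} {p : A ⊗[R] C → Prop} (h0 : p 0)
    (ht : ∀ a ∈ J, ∀ c, p (a ⊗ₜ c)) (hadd : ∀ x y, p x → p y → p (x + y)) {z : A ⊗[R] C}
    (hz : z ∈ extIdeal (R := R) C J) : p z := by
  obtain ⟨w, rfl⟩ := hz
  induction w with
  | zero => simpa using h0
  | tmul a c => exact ht a a.2 c
  | add x y hx hy => rw [map_add]; exact hadd _ _ hx hy

lemma extIdeal_mono {J J' : Ideal A} (h : J ≤ J') :
    extIdeal (R := R) C J ≤ extIdeal (R := R) C J' := fun _ hz =>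
  extIdeal_induction (zero_mem _) (fun _ ha c => tmul_mem_extIdeal (h ha) c)
    (fun _ _ hx hy => add_mem hx hy) hz

lemma mem_extIdeal_sup {J J' : Ideal A} {z : A ⊗[R] C}
    (hz : z ∈ extIdeal (R := R) C (J ⊔ J')) :
    ∃ u ∈ extIdeal (R := R) C J, ∃ v ∈ extIdeal (R := R) C J', z = u + v := by
  refine extIdeal_induction (p := fun z => ∃ u ∈ extIdeal (R := R) C J,
    ∃ v ∈ extIdeal (R := R) C J', z = u + v) ?_ ?_ ?_ hz
  · exact ⟨0, zero_mem _, 0, zero_mem _, by simp⟩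
  · intro a ha c
    obtain ⟨x, hx, y, hy, rfl⟩ := Submodule.mem_sup.1 ha
    exact ⟨_, tmul_mem_extIdeal hx c, _, tmul_mem_extIdeal hy c, add_tmul _ _ _⟩
  · rintro _ _ ⟨u, hu, v, hv, rfl⟩ ⟨u', hu', v', hv', rfl⟩
    exact ⟨_, add_mem hu hu', _, add_mem hv hv', add_add_add_comm _ _ _ _⟩

lemma smul_mem_extIdeal {J : Ideal A} (a : A) {z : A ⊗[R] C}
    (hz : z ∈ extIdeal (R := R) C J) : a • z ∈ extIdeal (R := R) C J := by
  refine extIdeal_induction (p := fun z => a • z ∈ extIdeal (R := R) C J) ?_ ?_ ?_ hz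
  · simp
  · intro b hb c
    exact tmul_mem_extIdeal (J.mul_mem_left a hb) c
  · intro x y hx hy
    rw [smul_add]
    exact add_mem hx hy

lemma smul_mem_extIdeal_of_mem {J : Ideal A} [J.IsTwoSided] {a : A} (ha : a ∈ J)
    (z : A ⊗[R] C) : a • z ∈ extIdeal (R := R) C J := by
  induction z with
  | zero => simp
  | tmul b c => exact tmul_mem_extIdeal (J.mul_mem_right b ha) c
  | add x y hx hy => rw [smul_add]; exact add_mem hx hy

lemma rTensor_eq_zero_iff {A' : Type*} [Ring A'] [Algebra R A'] {f : A →ₐ[R] A'}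
    (hf : Function.Surjective f) {z : A ⊗[R] C} :
    f.toLinearMap.rTensor C z = 0 ↔ z ∈ extIdeal (R := R) C (RingHom.ker f) := by
  refine rTensor_exact (f := ((RingHom.ker f).restrictScalars R).subtype) (g := f.toLinearMap) C
    (fun a => ?_) hf z
  simp

lemma mem_extIdeal_inf [Module.Flat R C] {J J' : Ideal A} {z : A ⊗[R] C}
    (hz : z ∈ extIdeal (R := R) C J) (hz' : z ∈ extIdeal (R := R) C J') :
    z ∈ extIdeal (R := R) C (J ⊓ J') := by
  obtain ⟨w, hw⟩ := mem_range_rTensor_inf hz hz'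
  rw [← hw]
  clear hw
  induction w with
  | zero => simp
  | tmul a c => exact tmul_mem_extIdeal (J := J ⊓ J') a.2 c
  | add x y hx hy => rw [map_add]; exact add_mem hx hy

lemma mem_extIdeal_finset_inf [Module.Flat R C] {ι : Type*} (s : Finset ι) (J : ι → Ideal A)
    {z : A ⊗[R] C} (hz : ∀ j ∈ s, z ∈ extIdeal (R := R) C (J j)) :
    z ∈ extIdeal (R := R) C (s.inf J) := by
  classical
  induction s using Finset.induction_on with
  | empty =>
    clear hz
    induction z with
    | zero => simp
    | tmul a c => exact tmul_mem_extIdeal (by simp) c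
    | add x y hx hy => exact add_mem hx hy
  | insert a s ha ih =>
    rw [Finset.inf_insert]
    exact mem_extIdeal_inf (hz a (Finset.mem_insert_self a s))
      (ih fun j hj => hz j (Finset.mem_insert_of_mem hj))

/-- The Chinese remainder theorem in `A ⊗ C`, for a sequence of left ideals of `A` satisfying
distributivity conditions and a flat module `C`. -/
lemma exists_crt [Module.Flat R C] {N : ℕ} (J : Fin N → Ideal A) (m : ℕ)
    (hJ : ∀ i : Fin N, i.val < m →
      (⨅ j : Fin N, ⨅ _ : j < i, (J j ⊔ J i)) ≤ (⨅ j : Fin N, ⨅ _ : j < i, J j) ⊔ J i)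
    (z : Fin N → A ⊗[R] C)
    (hz : ∀ i j : Fin N, i.val < m → j < i → z j - z i ∈ extIdeal (R := R) C (J j ⊔ J i)) :
    ∃ x, ∀ i : Fin N, i.val < m → x - z i ∈ extIdeal (R := R) C (J i) := by
  induction m with
  | zero => exact ⟨0, fun i hi => absurd hi (Nat.not_lt_zero _)⟩
  | succ m ih =>
    obtain ⟨x, hx⟩ := ih (fun i hi => hJ i (hi.trans (Nat.lt_succ_self m)))
      (fun i j hi => hz i j (hi.trans (Nat.lt_succ_self m)))
    by_cases hm : m < N
    · let i : Fin N := ⟨m, hm⟩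
      have hinf : ∀ J' : Fin N → Ideal A,
          (⨅ j : Fin N, ⨅ _ : j < i, J' j) = (Finset.univ.filter (· < i)).inf J' := by
        intro J'
        simp [Finset.inf_eq_iInf]
      -- Modulo each `J j + J i`, the partial solution `x` agrees with `z j`, hence with `z i`.
      have h1 : x - z i ∈ extIdeal (R := R) C (⨅ j : Fin N, ⨅ _ : j < i, (J j ⊔ J i)) := by
        rw [hinf]
        refine mem_extIdeal_finset_inf _ _ fun j hj => ?_
        have hj : j < i := by simpa using hj
        rw [← sub_add_sub_cancel x (z j) (z i)]
        exact add_mem (extIdeal_mono le_sup_left (hx j hj)) (hz i j (Nat.lt_succ_self m) hj)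
      obtain ⟨u, hu, v, hv, huv⟩ :=
        mem_extIdeal_sup (extIdeal_mono (hJ i (Nat.lt_succ_self m)) h1)
      -- The distributivity condition splits the error `x - z i` as `u + v`, with `u` in all the
      -- earlier ideals and `v` in `J i`. Removing `u` preserves the earlier congruences and leaves
      -- the error `v` at `i`.
      refine ⟨x - u, fun k hk => ?_⟩
      rcases Nat.lt_succ_iff_lt_or_eq.1 hk with hk | hk
      · rw [sub_right_comm]
        refine sub_mem (hx k hk) (extIdeal_mono ?_ hu)
        exact iInf₂_le k hk
      · obtain rfl : k = i := Fin.ext hk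
        rw [sub_right_comm, huv, add_sub_cancel_left]
        exact hv
    · exact ⟨x, fun i hi => hx i (by omega)⟩

/-- A left `A`-submodule of `A ⊗ C` which is everything modulo each of finitely many two-sided
ideals, and which contains the intersection of their extensions, is everything. -/
lemma mem_of_extIdeal [Module.Flat R C] {ι : Type*} (s : Finset ι) (J : ι → Ideal A)
    [∀ j, (J j).IsTwoSided] (U : Submodule A (A ⊗[R] C))
    (hU : ∀ j ∈ s, ∀ z, ∃ u ∈ U, z - u ∈ extIdeal (R := R) C (J j))
    (hU' : ∀ z, (∀ j ∈ s, z ∈ extIdeal (R := R) C (J j)) → z ∈ U) (z : A ⊗[R] C) : z ∈ U := by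
  classical
  suffices h : ∀ t ⊆ s, ∀ z, ∃ u ∈ U, ∀ j ∈ t, z - u ∈ extIdeal (R := R) C (J j) by
    obtain ⟨u, hu, hzu⟩ := h s subset_rfl z
    rw [← sub_add_cancel z u]
    exact add_mem (hU' _ hzu) hu
  intro t
  induction t using Finset.induction_on with
  | empty => exact fun _ z => ⟨0, zero_mem _, by simp⟩
  | insert i t hi ih =>
    intro ht z
    obtain ⟨u, hu, hzu⟩ := ih ((Finset.subset_insert i t).trans ht) z
    -- The remaining error is a sum of tensors `a ⊗ c` with `a` in all `J j`, `j ∈ t`. If `v`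
    -- approximates `1 ⊗ c` modulo `J i`, then `a • v` corrects `a ⊗ c` modulo `J i`, and `a • (1 ⊗
    -- c - v)` stays in the extensions of the old ideals since these are two-sided.
    have key : ∃ v ∈ U, ∀ j ∈ insert i t, (z - u) - v ∈ extIdeal (R := R) C (J j) := by
      refine extIdeal_induction (p := fun z => ∃ v ∈ U, ∀ j ∈ insert i t,
        z - v ∈ extIdeal (R := R) C (J j)) ?_ ?_ ?_ (mem_extIdeal_finset_inf t J hzu)
      · exact ⟨0, zero_mem _, by simp⟩
      · intro a ha c
        obtain ⟨v, hv, hcv⟩ := hU i (ht (Finset.mem_insert_self i t)) (1 ⊗ₜ c)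
        have h1 : a ⊗ₜ[R] c - a • v = a • (1 ⊗ₜ[R] c - v) := by
          rw [smul_sub, TensorProduct.smul_tmul', smul_eq_mul, mul_one]
        refine ⟨a • v, U.smul_mem a hv, fun j hj => ?_⟩
        rw [h1]
        rcases Finset.mem_insert.1 hj with rfl | hj
        · exact smul_mem_extIdeal a hcv
        · exact smul_mem_extIdeal_of_mem (Finset.inf_le (f := J) hj ha) _
      · rintro x y ⟨v, hv, hxv⟩ ⟨w, hw, hyw⟩
        refine ⟨v + w, add_mem hv hw, fun j hj => ?_⟩
        rw [add_sub_add_comm]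
        exact add_mem (hxv j hj) (hyw j hj)
    obtain ⟨v, hv, hzv⟩ := key
    exact ⟨u + v, add_mem hu hv, fun j hj => by rw [← sub_sub]; exact hzv j hj⟩

end ExtendedIdeal

/-! ### Reduction maps between the `B / J ⊗ C` -/

section FactorTensor

variable {R C B : Type*} [CommRing R] [AddCommGroup C] [Module R C]
  [Ring B] [Algebra R B]

lemma factor_surjective {J J' : Ideal B} [J.IsTwoSided] [J'.IsTwoSided] (h : J ≤ J') :
    Function.Surjective (Ideal.Quotient.factorₐ R h) :=
  Ideal.Quotient.factor_surjective h

variable (C) in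
/-- The map `B / J ⊗ C → B / J' ⊗ C` for `J ≤ J'`. -/
noncomputable abbrev factorTensor {J J' : Ideal B} [J.IsTwoSided] [J'.IsTwoSided] (h : J ≤ J') :
    (B ⧸ J) ⊗[R] C →ₗ[R] (B ⧸ J') ⊗[R] C :=
  (Ideal.Quotient.factorₐ R h).toLinearMap.rTensor C

lemma factorTensor_surjective {J J' : Ideal B} [J.IsTwoSided] [J'.IsTwoSided] (h : J ≤ J') :
    Function.Surjective (factorTensor (R := R) C h) :=
  LinearMap.rTensor_surjective C (factor_surjective (R := R) h)

lemma factorTensor_factorTensor {J J' J'' : Ideal B} [J.IsTwoSided] [J'.IsTwoSided]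
    [J''.IsTwoSided] (h : J ≤ J') (h' : J' ≤ J'') (z : (B ⧸ J) ⊗[R] C) :
    factorTensor (R := R) C h' (factorTensor C h z) = factorTensor C (h.trans h') z := by
  have h1 : (Ideal.Quotient.factorₐ R h').toLinearMap ∘ₗ (Ideal.Quotient.factorₐ R h).toLinearMap =
      (Ideal.Quotient.factorₐ R (h.trans h')).toLinearMap := by
    refine LinearMap.ext fun b => ?_
    obtain ⟨b, rfl⟩ := Ideal.Quotient.mk_surjective b
    rfl
  rw [factorTensor, factorTensor, factorTensor, ← h1, LinearMap.rTensor_comp_apply]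

variable {I : Type*} {K : I → Ideal B} [∀ i, (K i).IsTwoSided]

lemma mem_extIdeal_kerPi {i j : I} {z : (B ⧸ K j) ⊗[R] C} :
    z ∈ extIdeal (R := R) C (kerPi R K j i) ↔
      factorTensor (R := R) C (le_pairIdeal K (Sym2.mem_mk_left j i)) z = 0 :=
  (rTensor_eq_zero_iff (factor_surjective _)).symm

lemma ker_factor_le (i j k : I) (h : K k ≤ K i ⊔ K k ⊔ K j) :
    RingHom.ker (Ideal.Quotient.factorₐ R h) ≤ kerPi R K k i ⊔ kerPi R K k j := by
  intro b hb
  obtain ⟨b, rfl⟩ := Ideal.Quotient.mk_surjective b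
  have hb' : b ∈ K i ⊔ K k ⊔ K j := Ideal.Quotient.eq_zero_iff_mem.1 hb
  obtain ⟨u, hu, w, hw, rfl⟩ := Submodule.mem_sup.1 hb'
  obtain ⟨u, hu', v, hv, rfl⟩ := Submodule.mem_sup.1 hu
  rw [map_add, map_add, Ideal.Quotient.eq_zero_iff_mem.2 hv, add_zero]
  have key : ∀ l, ∀ a ∈ K l, Ideal.Quotient.mk (K k) a ∈ kerPi R K k l := fun l a ha =>
    Ideal.Quotient.eq_zero_iff_mem.2 (Submodule.mem_sup_right ha)
  exact add_mem (Submodule.mem_sup_left (key _ _ hu')) (Submodule.mem_sup_right (key _ _ hw))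

/-- The inequalities force `i = 1` and `m = 2`, so `j = 0` is the only index in either infimum and
nothing has to be distributed. -/
lemma iInf_kerPi_sup_le_of_le_three {N : ℕ} {K : Fin N → Ideal B}
    [∀ i, (K i).IsTwoSided] (hN : N ≤ 3) (m i : Fin N) (hi : 0 < i.val) (him : i < m) :
    (⨅ j : Fin N, ⨅ _ : j < i, (kerPi R K m j ⊔ kerPi R K m i)) ≤
      (⨅ j : Fin N, ⨅ _ : j < i, kerPi R K m j) ⊔ kerPi R K m i := by
  have hm := m.isLt
  let o : Fin N := ⟨0, by omega⟩
  refine (iInf₂_le o hi).trans (sup_le_sup_right (le_iInf₂ fun j hj => ?_) _)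
  obtain rfl : j = o := Fin.ext (show j.val = 0 by omega)
  exact le_rfl

end FactorTensor

/-! ### Matching elements and transition maps -/

section Matching

variable {R C B : Type*} [CommRing R] [AddCommGroup C] [Module R C] [Coalgebra R C]
  [Ring B] [Algebra R B] {I : Type*} {K : I → Ideal B} [∀ i, (K i).IsTwoSided]

/-- The gluing condition `χ^i_j(x) = χ^j_i(y)` in the trivializations. -/
def Matches (Γ : GaugeFamily K R C) (i j : I) (x : (B ⧸ K i) ⊗[R] C) (y : (B ⧸ K j) ⊗[R] C) :
    Prop :=
  ∀ (e : Sym2 I) (hi : i ∈ e) (hj : j ∈ e),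
    twist (Γ e i hi).val (factorTensor C (le_pairIdeal K hi) x) =
      twist (Γ e j hj).val (factorTensor C (le_pairIdeal K hj) y)

variable {Γ : GaugeFamily K R C} {i j : I}

namespace Matches

lemma refl (i : I) (x : (B ⧸ K i) ⊗[R] C) : Matches Γ i i x x := fun _ _ _ => rfl

lemma zero : Matches Γ i j 0 0 := fun _ _ _ => by simp

variable {x x' : (B ⧸ K i) ⊗[R] C} {y y' : (B ⧸ K j) ⊗[R] C}

lemma symm (h : Matches Γ i j x y) : Matches Γ j i y x := fun e hi hj => (h e hj hi).symm

lemma add (h : Matches Γ i j x y) (h' : Matches Γ i j x' y') :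
    Matches Γ i j (x + x') (y + y') := fun e hi hj => by
  simp only [map_add, h e hi hj, h' e hi hj]

lemma smul (b : B) (h : Matches Γ i j x y) :
    Matches Γ i j (Ideal.Quotient.mk (K i) b • x) (Ideal.Quotient.mk (K j) b • y) :=
  fun e hi hj => by
  rw [rTensor_algHom_smul, rTensor_algHom_smul, twist_smul, twist_smul, h e hi hj]
  rfl

/-- Cancelling the invertible twist by `Γ^j_i` turns matching into a transition by `Ξ_{ij}`. It can
then be pushed to any common quotient, in particular to `B_{ijk}`, where transitions are composed.
-/
lemma factorTensor_eq (h : Matches Γ i j x y) (J : Ideal B) [J.IsTwoSided] (hi : K i ≤ J)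
    (hj : K j ≤ J) :
    factorTensor C hj y = twist (pushXi Γ i j J hi hj) (factorTensor C hi x) := by
  have h1 := h s(i, j) (Sym2.mem_mk_left i j) (Sym2.mem_mk_right i j)
  have h2 : factorTensor C (le_pairIdeal K (Sym2.mem_mk_right i j)) y = twist (Xi Γ i j).val
      (factorTensor C (le_pairIdeal K (Sym2.mem_mk_left i j)) x) := by
    rw [Xi, Units.val_mul, twist_mul, h1, ← twist_mul, Units.mul_inv, twist_one]
  have h3 := congrArg (factorTensor C (pairIdeal_le K hi hj)) h2
  rw [factorTensor_factorTensor, rTensor_twist, factorTensor_factorTensor] at h3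
  exact h3

end Matches

lemma matches_of_ne (hij : i ≠ j) {x : (B ⧸ K i) ⊗[R] C} {y : (B ⧸ K j) ⊗[R] C}
    (h : twist (Γ s(j, i) i (Sym2.mem_mk_right j i)).val
      (factorTensor C (le_pairIdeal K (Sym2.mem_mk_right j i)) x) =
      twist (Γ s(j, i) j (Sym2.mem_mk_left j i)).val
      (factorTensor C (le_pairIdeal K (Sym2.mem_mk_left j i)) y)) :
    Matches Γ i j x y := by
  intro e hi hj
  obtain rfl : e = s(j, i) := (Sym2.mem_and_mem_iff hij.symm).1 ⟨hj, hi⟩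
  exact h

/-- Untwist by the inverse of `Γ^j_i` and lift from `B_{ij} ⊗ C` to `B_j ⊗ C`. By the next two
lemmas the choice is unique exactly up to the extension of `ker π^j_i`. -/
lemma exists_matches (Γ : GaugeFamily K R C) (hij : i ≠ j) (x : (B ⧸ K i) ⊗[R] C) :
    ∃ y, Matches Γ i j x y := by
  obtain ⟨y, hy⟩ := factorTensor_surjective (C := C)
    (le_pairIdeal K (Sym2.mem_mk_left j i))
    (twist (Γ s(j, i) j (Sym2.mem_mk_left j i))⁻¹.val
      (twist (Γ s(j, i) i (Sym2.mem_mk_right j i)).val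
        (factorTensor C (le_pairIdeal K (Sym2.mem_mk_right j i)) x)))
  refine ⟨y, matches_of_ne hij ?_⟩
  rw [hy, ← twist_mul, Units.inv_mul, twist_one]

lemma Matches.sub_mem_extIdeal {x : (B ⧸ K i) ⊗[R] C} {y y' : (B ⧸ K j) ⊗[R] C}
    (h : Matches Γ i j x y) (h' : Matches Γ i j x y') :
    y' - y ∈ extIdeal (R := R) C (kerPi R K j i) := by
  have h1 := (h s(j, i) (Sym2.mem_mk_right j i) (Sym2.mem_mk_left j i)).symm.trans
    (h' s(j, i) (Sym2.mem_mk_right j i) (Sym2.mem_mk_left j i))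
  have h2 := congrArg (twist (Γ s(j, i) j (Sym2.mem_mk_left j i))⁻¹.val) h1
  rw [← twist_mul, ← twist_mul, Units.mul_inv, twist_one, twist_one] at h2
  rw [mem_extIdeal_kerPi, map_sub, h2, sub_self]

lemma Matches.of_sub_mem_extIdeal (hij : i ≠ j) {x : (B ⧸ K i) ⊗[R] C}
    {y y' : (B ⧸ K j) ⊗[R] C} (h : Matches Γ i j x y)
    (hy : y' - y ∈ extIdeal (R := R) C (kerPi R K j i)) : Matches Γ i j x y' := by
  rw [mem_extIdeal_kerPi, map_sub, sub_eq_zero] at hy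
  refine matches_of_ne hij ?_
  rw [hy]
  exact h _ _ _

end Matching

/-! ### Extending matching families under the cocycle condition -/

section Extension

variable {R C B : Type*} [CommRing R] [AddCommGroup C] [Module R C] [Coalgebra R C]
  [Ring B] [Algebra R B] {N : ℕ} {K : Fin N → Ideal B} [∀ i, (K i).IsTwoSided]
  {Γ : GaugeFamily K R C}

/-- Families of elements of `B_i ⊗ C` whose members with index less than `m` match. -/
def MatchesBelow (Γ : GaugeFamily K R C) (m : ℕ) (x : ∀ i, (B ⧸ K i) ⊗[R] C) : Prop :=
  ∀ i j : Fin N, i.val < m → j.val < m → Matches Γ i j (x i) (x j)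

lemma MatchesBelow.update {m : Fin N} {x : ∀ i, (B ⧸ K i) ⊗[R] C} (hx : MatchesBelow Γ m x)
    {z : (B ⧸ K m) ⊗[R] C} (hz : ∀ j < m, Matches Γ j m (x j) z) :
    MatchesBelow Γ (m + 1) (Function.update x m z) := by
  have hlt : ∀ {i : Fin N}, i.val < m + 1 → i = m ∨ i < m := fun {i} hi =>
    (Nat.lt_succ_iff_lt_or_eq.1 hi).symm.imp Fin.ext id
  intro i j hi hj
  rcases hlt hi with rfl | hi
  · rcases hlt hj with rfl | hj
    · exact Matches.refl _ _
    · rw [Function.update_self, Function.update_of_ne hj.ne]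
      exact (hz j hj).symm
  · rcases hlt hj with rfl | hj
    · rw [Function.update_self, Function.update_of_ne hi.ne]
      exact hz i hi
    · rw [Function.update_of_ne hi.ne, Function.update_of_ne hj.ne]
      exact hx i j hi hj

/-- A matching family on the indices below `m` extends to `m`. -/
lemma MatchesBelow.exists_extension [Module.Flat R C] (hΓ : IsCocycle Γ) (m : Fin N)
    (hK : ∀ i : Fin N, 0 < i.val → i < m →
      (⨅ j : Fin N, ⨅ _ : j < i, (kerPi R K m j ⊔ kerPi R K m i)) ≤
        (⨅ j : Fin N, ⨅ _ : j < i, kerPi R K m j) ⊔ kerPi R K m i)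
    {x : ∀ i, (B ⧸ K i) ⊗[R] C} (hx : MatchesBelow Γ m x) :
    ∃ z, ∀ j < m, Matches Γ j m (x j) z := by
  have hex : ∀ j, ∃ z, j < m → Matches Γ j m (x j) z := by
    intro j
    by_cases hj : j < m
    · obtain ⟨z, hz⟩ := exists_matches Γ hj.ne (x j)
      exact ⟨z, fun _ => hz⟩
    · exact ⟨0, fun h => absurd h hj⟩
  choose z hz using hex
  suffices h : ∃ w, ∀ j : Fin N, j.val < m → w - z j ∈ extIdeal (R := R) C (kerPi R K m j) by
    obtain ⟨w, hw⟩ := h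
    exact ⟨w, fun j hj => (hz j hj).of_sub_mem_extIdeal hj.ne (hw j hj)⟩
  apply exists_crt
  · intro i hi
    rcases Nat.eq_zero_or_pos i.val with h0 | h0
    -- For `i = 0` the infima are empty, so the condition is trivial; the hypothesis covers only
    -- positive `i`.
    · exact le_sup_of_le_left (le_iInf₂ fun j hj => absurd hj (by omega))
    · exact hK i h0 hi
  · intro i j hi hji
    have hj : j < m := hji.trans hi
    have hkm : K m ≤ K j ⊔ K m ⊔ K i := le_sup_right.trans le_sup_left
    -- It is enough that `z j` and `z i` agree over `B_{jmi}`, since the kernel of `B_m → B_{jmi}`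
    -- lies in `ker π^m_j + ker π^m_i`.
    refine extIdeal_mono (ker_factor_le (R := R) j i m hkm)
      ((rTensor_eq_zero_iff (factor_surjective hkm)).1 ?_)
    rw [map_sub, sub_eq_zero]
    have h1 := (hz j hj).factorTensor_eq (K j ⊔ K m ⊔ K i) (le_sup_left.trans le_sup_left) hkm
    have h2 := (hz i hi).factorTensor_eq (K j ⊔ K m ⊔ K i) le_sup_right hkm
    have h3 := (hx j i hj hi).factorTensor_eq (K j ⊔ K m ⊔ K i) (le_sup_left.trans le_sup_left)
      le_sup_right
    -- Going from `j` to `m` directly or through `i` gives the same twist: `Ξ_{jm} = Ξ_{ji} *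
    -- Ξ_{im}`.
    rw [h1, h2, h3, ← twist_mul, hΓ j m i]

/-- Every element of `B_n ⊗ C` is a member of a matching family. -/
lemma exists_matchesBelow [Module.Flat R C] (hΓ : IsCocycle Γ)
    (hK : ∀ m i : Fin N, 0 < i.val → i < m →
      (⨅ j : Fin N, ⨅ _ : j < i, (kerPi R K m j ⊔ kerPi R K m i)) ≤
        (⨅ j : Fin N, ⨅ _ : j < i, kerPi R K m j) ⊔ kerPi R K m i)
    (m : ℕ) (n : Fin N) (hn : n.val < m) (y : (B ⧸ K n) ⊗[R] C) :
    ∃ x : ∀ i, (B ⧸ K i) ⊗[R] C, MatchesBelow Γ m x ∧ x n = y := by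
  induction m generalizing n with
  | zero => exact absurd hn (Nat.not_lt_zero _)
  | succ m ih =>
    by_cases hm : m < N
    · obtain ⟨k, rfl⟩ : ∃ k : Fin N, k.val = m := ⟨⟨m, hm⟩, rfl⟩
      rcases Nat.lt_succ_iff_lt_or_eq.1 hn with hn | hn
      · obtain ⟨x, hx, rfl⟩ := ih n hn y
        obtain ⟨z, hz⟩ := hx.exists_extension hΓ k (hK k)
        exact ⟨_, hx.update hz, Function.update_of_ne (ne_of_lt (α := Fin N) hn) _ _⟩
      · obtain rfl : n = k := Fin.ext hn
        -- Here the value is prescribed at the newest index. `U` collects the values there that are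
        -- compatible with some matching family on the smaller indices.
        let U : Submodule (B ⧸ K n) ((B ⧸ K n) ⊗[R] C) :=
          { carrier := {z | ∃ x, MatchesBelow Γ n x ∧ ∀ j < n, Matches Γ j n (x j) z}
            zero_mem' := ⟨0, fun _ _ _ _ => Matches.zero, fun _ _ => Matches.zero⟩
            add_mem' := by
              rintro z z' ⟨x, hx, hz⟩ ⟨x', hx', hz'⟩
              exact ⟨x + x', fun i j hi hj => (hx i j hi hj).add (hx' i j hi hj),
                fun j hj => (hz j hj).add (hz' j hj)⟩
            smul_mem' := by
              rintro b z ⟨x, hx, hz⟩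
              obtain ⟨b, rfl⟩ := Ideal.Quotient.mk_surjective b
              exact ⟨fun i => Ideal.Quotient.mk (K i) b • x i,
                fun i j hi hj => (hx i j hi hj).smul b, fun j hj => (hz j hj).smul b⟩ }
        have hy : y ∈ U := by
          refine mem_of_extIdeal (Finset.univ.filter (· < n)) (fun j => kerPi R K n j) U ?_ ?_ y
          · intro j hj z
            have hj : j < n := by simpa using hj
            -- Surjectivity of `U` modulo `ker π^n_j`: move `z` to the index `j < n`, complete to a
            -- family below `n` by induction, and extend back to `n`. The result and `z` both match
            -- `w`, so they differ by an element of the extended kernel.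
            obtain ⟨w, hw⟩ := exists_matches Γ hj.ne' z
            obtain ⟨x, hx, rfl⟩ := ih j hj w
            obtain ⟨u, hu⟩ := hx.exists_extension hΓ n (hK n)
            exact ⟨u, ⟨x, hx, hu⟩, (hu j hj).sub_mem_extIdeal hw.symm⟩
          · intro z hz
            -- An element in all the extended kernels matches the zero family.
            refine ⟨0, fun _ _ _ _ => Matches.zero, fun j hj => ?_⟩
            refine Matches.of_sub_mem_extIdeal hj.ne Matches.zero ?_
            rw [sub_zero]
            exact hz j (by simpa using hj)
        obtain ⟨x, hx, hz⟩ := hy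
        exact ⟨_, hx.update hz, Function.update_self _ _ _⟩
    · obtain ⟨x, hx, rfl⟩ := ih n (by omega) y
      exact ⟨x, fun i j _ _ => hx i j (by omega) (by omega), rfl⟩

end Extension

/-! ### The glued algebra in the trivializations -/

section GluingTriv

variable {R C B : Type*} [CommRing R] [AddCommGroup C] [Module R C] [Coalgebra R C]
  [Ring B] [Algebra R B] {I : Type*} {K : I → Ideal B} [∀ i, (K i).IsTwoSided]
  {P : I → Type*} [∀ i, Ring (P i)] [∀ i, Algebra R (P i)] [∀ i, RightComodule R C (P i)]
  {Q : Sym2 I → Type*} [∀ e, Ring (Q e)] [∀ e, Algebra R (Q e)] [∀ e, RightComodule R C (Q e)]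
  {E : ∀ i, CleftExtension R C (B ⧸ K i) (P i)}
  {F : ∀ e, CleftExtension R C (B ⧸ pairIdeal K e) (Q e)}
  {χ : ∀ (e : Sym2 I) (i : I), i ∈ e → (P i →ₐ[R] Q e)} {Γ : GaugeFamily K R C}

lemma triv_mem_gluing_iff (hχ : ∀ e i hi (p : P i),
      χ e i hi p = gaugeMap (E i) (F e) (piPair R K e i hi) (Γ e i hi).val p)
    (x : ∀ i, (B ⧸ K i) ⊗[R] C) :
    (fun i => (E i).triv (x i)) ∈ gluing χ ↔ ∀ i j, Matches Γ i j (x i) (x j) := by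
  have key : ∀ e i hi, χ e i hi ((E i).triv (x i)) =
      (F e).triv (twist (Γ e i hi).val (factorTensor C (le_pairIdeal K hi) (x i))) :=
    fun e i hi => by rw [hχ, gaugeMap_triv]
  constructor
  · intro h i j e hi hj
    apply (F e).triv_injective
    rw [← key, ← key]
    exact h e i j hi hj
  · intro h e i j hi hj
    rw [key, key, h i j e hi hj]

lemma gluingProj_surjective_iff (hχ : ∀ e i hi (p : P i),
      χ e i hi p = gaugeMap (E i) (F e) (piPair R K e i hi) (Γ e i hi).val p) (n : I) :
    Function.Surjective (gluingProj χ n) ↔ ∀ y : (B ⧸ K n) ⊗[R] C,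
      ∃ x : ∀ i, (B ⧸ K i) ⊗[R] C, (∀ i j, Matches Γ i j (x i) (x j)) ∧ x n = y := by
  constructor
  · intro h y
    obtain ⟨p, hp⟩ := h ((E n).triv y)
    have hpE : (fun i => (E i).triv ((E i).untriv (p.1 i))) = p.1 :=
      funext fun i => (E i).triv_untriv _
    refine ⟨fun i => (E i).untriv (p.1 i), ?_, ?_⟩
    · rw [← triv_mem_gluing_iff hχ, hpE]
      exact p.2
    · exact (congrArg (E n).untriv hp).trans ((E n).untriv_triv y)
  · intro h p
    obtain ⟨x, hx, hxn⟩ := h ((E n).untriv p)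
    refine ⟨⟨_, (triv_mem_gluing_iff hχ x).2 hx⟩, ?_⟩
    exact (congrArg (E n).triv hxn).trans ((E n).triv_untriv p)

/-- Every element of `B_{ijk} ⊗ C` lifts to `B_i ⊗ C` and so to a matching family. Its member at
`j`, reached from `i` directly or through `k`, shows that the two twists agree on that element;
twists determine their maps. -/
lemma isCocycle_of_matches (h : ∀ n, ∀ y : (B ⧸ K n) ⊗[R] C,
      ∃ x : ∀ i, (B ⧸ K i) ⊗[R] C, (∀ i j, Matches Γ i j (x i) (x j)) ∧ x n = y) :
    IsCocycle Γ := by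
  intro i j k
  apply twist_injective
  refine LinearMap.ext fun z => ?_
  obtain ⟨y, rfl⟩ := factorTensor_surjective (C := C)
    (le_sup_left.trans le_sup_left : K i ≤ K i ⊔ K j ⊔ K k) z
  obtain ⟨x, hx, rfl⟩ := h i y
  rw [twist_mul, ← (hx i j).factorTensor_eq, ← (hx i k).factorTensor_eq,
    ← (hx k j).factorTensor_eq]

end GluingTriv

end CleftGluing

theorem mainTheorem4 {R C B : Type*} [CommRing R]
    [AddCommGroup C] [Module R C] [Coalgebra R C] [Ring B] [Algebra R B]
    {N : ℕ} (K : Fin N → Ideal B) [∀ i, (K i).IsTwoSided]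
    (hK : IsCompleteCovering R K)
    {P : Fin N → Type*} [∀ i, Ring (P i)] [∀ i, Algebra R (P i)]
    [∀ i, RightComodule R C (P i)]
    {Q : Sym2 (Fin N) → Type*} [∀ e, Ring (Q e)] [∀ e, Algebra R (Q e)]
    [∀ e, RightComodule R C (Q e)]
    (E : ∀ i, CleftExtension R C (B ⧸ K i) (P i))
    (F : ∀ e, CleftExtension R C (B ⧸ pairIdeal K e) (Q e))
    (hE : ∀ i, ∃ y : B ⧸ K i, (E i).base 1 * y = 1)
    (χ : ∀ (e : Sym2 (Fin N)) (i : Fin N), i ∈ e → (P i →ₐ[R] Q e))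
    (hχsurj : ∀ e i hi, Function.Surjective (χ e i hi))
    (hχcolin : ∀ e i hi, IsColinear R C (χ e i hi).toLinearMap) :
    ((∀ e i hi (b : B ⧸ K i), χ e i hi ((E i).incl b) = (F e).incl (piPair R K e i hi b)) ↔
      ∃ Γ : GaugeFamily K R C, ∀ e i hi (p : P i),
        χ e i hi p = gaugeMap (E i) (F e) (piPair R K e i hi) (Γ e i hi).val p) ∧
    (Module.Flat R C →
      (N ≤ 3 ∨ ∀ m i : Fin N, 0 < i.val → i < m →
        (⨅ j : Fin N, ⨅ _ : j < i, (kerPi R K m j ⊔ kerPi R K m i)) =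
          (⨅ j : Fin N, ⨅ _ : j < i, kerPi R K m j) ⊔ kerPi R K m i) →
      ∀ Γ : GaugeFamily K R C,
        (∀ e i hi (p : P i),
          χ e i hi p = gaugeMap (E i) (F e) (piPair R K e i hi) (Γ e i hi).val p) →
        ((∀ n, Function.Surjective (gluingProj χ n)) ↔ IsCocycle Γ)) := by
  refine ⟨⟨fun h => ?_, ?_⟩, fun hflat hN Γ hΓ => ⟨fun h => ?_, fun h n => ?_⟩⟩
  · choose Γ hΓ using fun e i hi =>
      exists_gauge (E i) (F e) (piPair R K e i hi) (χ e i hi) (hχcolin e i hi) (h e i hi)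
    exact ⟨Γ, hΓ⟩
  · rintro ⟨Γ, hΓ⟩ e i hi b
    exact map_incl_of_eq_gaugeMap (E i) (F e) _ (χ e i hi) _ (hΓ e i hi) b
  · exact isCocycle_of_matches fun n => (gluingProj_surjective_iff hΓ n).1 (h n)
  · refine (gluingProj_surjective_iff hΓ n).2 fun y => ?_
    have hdist : ∀ m i : Fin N, 0 < i.val → i < m →
        (⨅ j : Fin N, ⨅ _ : j < i, (kerPi R K m j ⊔ kerPi R K m i)) ≤
          (⨅ j : Fin N, ⨅ _ : j < i, kerPi R K m j) ⊔ kerPi R K m i := by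
      rcases hN with hN | hN
      · exact iInf_kerPi_sup_le_of_le_three hN
      · exact fun m i hi him => (hN m i hi him).le
    obtain ⟨x, hx, hxn⟩ := exists_matchesBelow h hdist N n n.isLt y
    exact ⟨x, fun i j => hx i j i.isLt j.isLt, hxn⟩
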